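/- Let $\mathcal S,\mathcal A$ be finite nonempty sets and $H\ge 1$. Let $P^o_{h,s,a}\in\Delta(\mathcal S)$ be nominal transition probabilities and $r_h(s,a)\in[0,1]$ known rewards, for $h\in\{1,\dots,H\}$, $s\in\mathcal S$, $a\in\mathcal A$. For $\rho>0$ and $Q\in\Delta(\mathcal S)$ let $\mathcal B_\rho(Q)=\{P\in\Delta(\mathcal S): D_{\mathrm{KL}}(P,Q)\le\rho\}$, where $D_{\mathrm{KL}}(P,Q)=\sum_{s'}P(s')\log\frac{P(s')}{Q(s')}$ ($=+\infty$ if $P\not\ll Q$), and let $L_{Q}V=\inf\{\sum_{s'}P(s')V(s'):P\in\mathcal B_\rho(Q)\}$ for $V\in\mathbb R^{\mathcal S}$. For a deterministic Markov policy $\pi=(\pi_h)_{h=1}^H$, $\pi_h:\mathcal S\to\mathcal A$, let $V^{\pi,P}(s)$ be the expectation of $\sum_{t=1}^H r_t(s_t,\pi_t(s_t))$ for $s_1=s$, $s_{t+1}\sim P_{t,s_t,\pi_t(s_t)}$. Let $V^\pi(s)=\inf_P V^{\pi,P}(s)$, the infimum over all $P=(P_{h,s,a})$ with $P_{h,s,a}\in\mathcal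 B_\rho(P^o_{h,s,a})$ for every $(h,s,a)$, and $V^*(s)=\sup_\pi V^\pi(s)$. Let $p_{\min}=\min\{P^o_{h,s,a}(s') : P^o_{h,s,a}(s')>0\}$. Robust Phased Value Learning (RPVL) draws, for each $(h,s,a)$, $N$ samples from $P^o_{h,s,a}$, all samples being independent, so that $N_{\mathrm{total}}=N|\mathcal S||\mathcal A|H$. It forms the empirical frequencies $\widehat P_{h,s,a}$, sets $\widehat V_{H+1}=0$ and, for $h=H,\dots,1$, $$\widehat V_h(s)=\max_a\{r_h(s,a)+L_{\widehat P_{h,s,a}}\widehat V_{h+1}\},\qquad \hat\pi_h(s)\in\operatorname*{arg\,max}_a\{r_h(s,a)+L_{\widehat P_{h,s,a}}\widehat V_{h+1}\},$$ and outputs $\hat\pi$ (ties broken arbitrarily). Let $\delta\in(0,1)$, $\rho>0$, $\varepsilon\in(0,H)$. If $$N_{\mathrm{total}}\ \ge\ \frac{2H^5|\mathcal S||\mathcal A|}{\rho^2p_{\min}^2\varepsilon^2}\log\frac{2H|\mathcal S|^2|\mathcal A|}{\delta}$$ and $N$ is also at least the problem-dependent constant, independent of $\varepsilon$, $\frac1{p_{\min}^2}\log\frac{2H|\mathcal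 S|^2|\mathcal A|}{\delta}$ (a condition that is implied by the first one whenever $\rho\varepsilon\le\sqrt2\,H^2$, in particular whenever $\rho\le H$), then, with probability at least $1-\delta$, $\|V^*-V^{\hat\pi}\|_\infty\le\varepsilon$. -/

import Mathlib

open scoped BigOperators

noncomputable section

namespace RobustMDP

/-- Data of a tabular finite-horizon problem with horizon `H`: a nominal transition model and a
deterministic reward with values in `[0,1]`. Times `1, …, H` are represented by `Fin H`;
`trans h s a s'` is the nominal probability of moving from `s` to `s'` under action `a` at
time `h`. -/
structure NominalMDP (S A : Type*) [Fintype S] (H : ℕ) where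
  trans : Fin H → S → A → S → ℝ
  trans_mem : ∀ h s a, trans h s a ∈ stdSimplex ℝ S
  reward : Fin H → S → A → ℝ
  reward_mem : ∀ h s a, reward h s a ∈ Set.Icc (0 : ℝ) 1

/-- Deterministic non-stationary Markov policies. -/
abbrev Policy (S A : Type*) (H : ℕ) := Fin H → S → A

section Divergence

variable {S : Type*} [Fintype S]

open Classical in
/-- Kullback-Leibler divergence `∑ P log (P / Q)` of two probability vectors, with the usual
conventions `0 log (0 / q) = 0` and `p log (p / 0) = +∞` for `p > 0`. -/
def klDist (P Q : S → ℝ) : EReal :=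
  if ∀ s, Q s = 0 → P s = 0 then ((∑ s, P s * Real.log (P s / Q s) : ℝ) : EReal) else ⊤

/-- The KL ball of radius `ρ` around `Q` in the probability simplex. -/
def klBall (ρ : ℝ) (Q : S → ℝ) : Set (S → ℝ) :=
  {P | P ∈ stdSimplex ℝ S ∧ klDist P Q ≤ (ρ : EReal)}

/-- The worst-case expectation `inf {P V : P in the KL ball of radius ρ around Q}`. -/
def worstExp (ρ : ℝ) (Q V : S → ℝ) : ℝ :=
  sInf ((fun P : S → ℝ => ∑ s, P s * V s) '' klBall ρ Q)

end Divergence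

section Values

variable {S A : Type*} [Fintype S] {H : ℕ}

open Classical in
/-- Probability of the trajectory `x = (s_1, …, s_{H+1})` when the initial state is `s₀`, the
policy is `π`, and `s_{t+1}` is drawn from `P t s_t (π t s_t)`. -/
def pathProb (P : Fin H → S → A → S → ℝ) (π : Policy S A H) (s₀ : S) (x : Fin (H + 1) → S) : ℝ :=
  (if x 0 = s₀ then 1 else 0) *
    ∏ t : Fin H, P t (x t.castSucc) (π t (x t.castSucc)) (x t.succ)

open Classical in
/-- Value `V^{π,P}(s₀)`, from the first time on: the expected total reward over trajectories. -/
def value (P : Fin H → S → A → S → ℝ) (r : Fin H → S → A → ℝ) (π : Policy S A H) (s₀ : S) : ℝ :=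
  ∑ x : Fin (H + 1) → S,
    pathProb P π s₀ x * ∑ t : Fin H, r t (x t.castSucc) (π t (x t.castSucc))

namespace NominalMDP

variable (M : NominalMDP S A H)

/-- The rectangular KL uncertainty set: every time-state-action triple has its own KL ball. -/
def uncertaintySet (ρ : ℝ) : Set (Fin H → S → A → S → ℝ) :=
  {P | ∀ h s a, P h s a ∈ klBall ρ (M.trans h s a)}

/-- Robust value of a policy: the infimum of its values over the uncertainty set. -/
def robustValue (ρ : ℝ) (π : Policy S A H) (s : S) : ℝ :=
  ⨅ P : M.uncertaintySet ρ, value P.1 M.reward π s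

/-- Optimal robust value: the supremum of the robust values over all policies. -/
def optRobustValue (ρ : ℝ) (s : S) : ℝ :=
  ⨆ π : Policy S A H, M.robustValue ρ π s

/-- The smallest positive nominal transition probability. -/
def pmin : ℝ :=
  sInf {p | 0 < p ∧ ∃ h s a s', p = M.trans h s a s'}

end NominalMDP

/-- Value functions computed by robust phased value learning from an estimated model `Q`, by
backward recursion: `0` at time `H + 1`, and the robust Bellman update at each earlier time. -/
def rpvlValue (ρ : ℝ) (r : Fin H → S → A → ℝ) (Q : Fin H → S → A → S → ℝ) (h : Fin (H + 1)) :
    S → ℝ :=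
  Fin.reverseInduction (motive := fun _ => S → ℝ) (fun _ => 0)
    (fun h V s => ⨆ a : A, r h s a + worstExp ρ (Q h s a) V) h

/-- All possible outputs of robust phased value learning run on the estimated model `Q`, that
is, all choices of maximizing actions (ties may be broken in any way). -/
def rpvlOutputs (ρ : ℝ) (r : Fin H → S → A → ℝ) (Q : Fin H → S → A → S → ℝ) :
    Set (Policy S A H) :=
  {π | ∀ h s, ∀ a : A,
    r h s a + worstExp ρ (Q h s a) (rpvlValue ρ r Q h.succ) ≤
      r h s (π h s) + worstExp ρ (Q h s (π h s)) (rpvlValue ρ r Q h.succ)}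

end Values

section Sampling

variable {S A Ω : Type*} {H N : ℕ}

/-- `X h s a i` is the `i`-th next-state sample drawn at `(h, s, a)` from the generative model:
all samples are jointly independent, and those at `(h, s, a)` have law `M.trans h s a`. -/
structure IsGenerativeSample [Fintype S] [MeasurableSpace S] [MeasurableSpace Ω]
    (M : NominalMDP S A H) (μ : MeasureTheory.Measure Ω)
    (X : Fin H → S → A → Fin N → Ω → S) : Prop where
  measurable : ∀ h s a i, Measurable (X h s a i)
  law : ∀ h s a i s', μ.real {ω | X h s a i ω = s'} = M.trans h s a s'
  indep : ProbabilityTheory.iIndepFun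
    (fun k : Fin H × S × A × Fin N => X k.1 k.2.1 k.2.2.1 k.2.2.2) μ

open Classical in
/-- Maximum likelihood estimate of the transition model: the empirical frequencies. -/
def empirical (X : Fin H → S → A → Fin N → Ω → S) (ω : Ω) : Fin H → S → A → S → ℝ :=
  fun h s a s' => ((Finset.univ.filter fun i : Fin N => X h s a i ω = s').card : ℝ) / N

end Sampling

end RobustMDP

end

namespace RobustMDP

/-! ### KL balls and worst-case expectations -/

section KLBall

variable {S : Type*} [Fintype S]

/-! The empirical and nominal models are compared multiplicatively. If each transition probability
of either model is at most `exp κ` times that of the other, replacing one centre by the other raises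
the KL divergence of any `P` by at most `κ`. By convexity, mixing `P` with the new centre with
weight `κ / (ρ + κ)` brings the divergence back to `ρ`, and changes the mean of a function with
values in `[0, B]` by at most `κ B / ρ` upwards (`exists_mem_klBall_le_add`).

With `h` stages left after the current one, continuation values lie in `[0, h]`, so a stage costs `κ
h / ρ` and all stages together at most `κ H² / (2ρ)`. The computed value thus bounds, up to this
error, every policy's robust value from above and the learnt policy's robust value from below; the
suboptimality is at most `κ H² / ρ` (`NominalMDP.norm_optRobustValue_sub_le`).

Hoeffding and a union bound give additive accuracy `t` for all frequencies. Positive nominal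
probabilities are at least `pmin`, so this becomes `κ = 2 t / pmin`; zero nominal probabilities are
almost surely estimated as zero. -/

theorem mem_klBall_iff {ρ : ℝ} {P Q : S → ℝ} :
    P ∈ klBall ρ Q ↔ P ∈ stdSimplex ℝ S ∧ (∀ s, Q s = 0 → P s = 0) ∧
      ∑ s, P s * Real.log (P s / Q s) ≤ ρ := by
  change (_ ∧ klDist P Q ≤ (ρ : EReal)) ↔ _
  unfold klDist
  by_cases h : ∀ s, Q s = 0 → P s = 0
  · rw [if_pos h, EReal.coe_le_coe_iff]
    exact ⟨fun hP => ⟨hP.1, h, hP.2⟩, fun hP => ⟨hP.1, hP.2.2⟩⟩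
  · simp [h]

theorem self_mem_klBall {ρ : ℝ} (hρ : 0 ≤ ρ) {Q : S → ℝ} (hQ : Q ∈ stdSimplex ℝ S) :
    Q ∈ klBall ρ Q := by
  refine mem_klBall_iff.2 ⟨hQ, fun _ h => h, ?_⟩
  rw [Finset.sum_eq_zero]
  · exact hρ
  · intro s _
    by_cases h : Q s = 0 <;> simp [h]

/-- Mean values of a function with values in `[0, B]` lie in `[0, B]`. -/
theorem sum_mul_mem_Icc {P V : S → ℝ} {B : ℝ} (hP : P ∈ stdSimplex ℝ S)
    (hV : ∀ s, V s ∈ Set.Icc 0 B) : ∑ s, P s * V s ∈ Set.Icc 0 B := by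
  constructor
  · exact Finset.sum_nonneg fun s _ => mul_nonneg (hP.1 s) (hV s).1
  · calc ∑ s, P s * V s ≤ ∑ s, P s * B :=
        Finset.sum_le_sum fun s _ => mul_le_mul_of_nonneg_left (hV s).2 (hP.1 s)
      _ = B := by rw [← Finset.sum_mul, hP.2, one_mul]

theorem worstExp_le {ρ : ℝ} {P Q V : S → ℝ} (hV : ∀ s, 0 ≤ V s) (hP : P ∈ klBall ρ Q) :
    worstExp ρ Q V ≤ ∑ s, P s * V s := by
  refine csInf_le ⟨0, ?_⟩ ⟨P, hP, rfl⟩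
  rintro _ ⟨P', hP', rfl⟩
  exact Finset.sum_nonneg fun s _ => mul_nonneg (hP'.1.1 s) (hV s)

theorem worstExp_nonneg (ρ : ℝ) (Q : S → ℝ) {V : S → ℝ} (hV : ∀ s, 0 ≤ V s) :
    0 ≤ worstExp ρ Q V := by
  -- No nonemptiness is needed: the real infimum of the empty set is `0`.
  apply Real.sInf_nonneg
  rintro _ ⟨P', hP', rfl⟩
  exact Finset.sum_nonneg fun s _ => mul_nonneg (hP'.1.1 s) (hV s)

/-- Approximate minimizers suffice below, so attainment of the infimum is never needed. -/
theorem exists_mem_klBall_lt_worstExp_add {ρ : ℝ} (hρ : 0 ≤ ρ) {Q : S → ℝ}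
    (hQ : Q ∈ stdSimplex ℝ S) (V : S → ℝ) {η : ℝ} (hη : 0 < η) :
    ∃ P ∈ klBall ρ Q, ∑ s, P s * V s < worstExp ρ Q V + η := by
  obtain ⟨_, ⟨P, hP, rfl⟩, h⟩ := exists_lt_of_csInf_lt
    (Set.Nonempty.image (fun P : S → ℝ => ∑ s, P s * V s) ⟨Q, self_mem_klBall hρ hQ⟩)
    (lt_add_of_pos_right (worstExp ρ Q V) hη)
  exact ⟨P, hP, h⟩

/-- Convexity of `x ↦ x log (x / q)`, on the segment from `p` to `q`. -/
theorem mix_mul_log_le {p q t : ℝ} (hp : 0 ≤ p) (hq : 0 < q) (ht₀ : 0 ≤ t) (ht₁ : t ≤ 1) :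
    ((1 - t) * p + t * q) * Real.log (((1 - t) * p + t * q) / q) ≤
      (1 - t) * (p * Real.log (p / q)) := by
  have h := Real.convexOn_mul_log.2 (x := p / q) (y := 1)
    (Set.mem_Ici.2 (by positivity)) (Set.mem_Ici.2 zero_le_one) (sub_nonneg.2 ht₁) ht₀ (by ring)
  simp only [smul_eq_mul, Real.log_one, mul_zero, add_zero, mul_one] at h
  have e : ((1 - t) * p + t * q) / q = (1 - t) * (p / q) + t := by field_simp
  have e' : (1 - t) * p + t * q = q * ((1 - t) * (p / q) + t) := by field_simp
  rw [e]
  nth_rewrite 1 [e']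
  calc _ = q * (((1 - t) * (p / q) + t) * Real.log ((1 - t) * (p / q) + t)) := by ring
    _ ≤ q * ((1 - t) * (p / q * Real.log (p / q))) := mul_le_mul_of_nonneg_left h hq.le
    _ = _ := by field_simp

/-- Moving the centre of a KL ball from `p` to `q` increases the divergence of a member by at most
the bound `κ` on the log-ratio of the centres; mixing with `q` compensates for that. -/
theorem exists_mem_klBall_le_add {ρ κ B : ℝ} (hρ : 0 < ρ) (hκ : 0 ≤ κ) {p q P V : S → ℝ}
    (hq : q ∈ stdSimplex ℝ S) (hpq : ∀ s, p s ≤ Real.exp κ * q s) (hp : ∀ s, 0 ≤ p s)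
    (hP : P ∈ klBall ρ p) (hV : ∀ s, V s ∈ Set.Icc 0 B) :
    ∃ Q ∈ klBall ρ q, ∑ s, Q s * V s ≤ ∑ s, P s * V s + κ / ρ * B := by
  obtain ⟨hPs, hPac, hPkl⟩ := mem_klBall_iff.1 hP
  -- The weight that solves `(1 - t) * (ρ + κ) = ρ`.
  set t := κ / (ρ + κ) with ht
  have hρκ : 0 < ρ + κ := by linarith
  have ht₀ : 0 ≤ t := by positivity
  have ht₁ : t ≤ 1 := (div_le_one hρκ).2 (by linarith)
  have htρ : t ≤ κ / ρ := div_le_div_of_nonneg_left hκ hρ (by linarith)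
  have hac : ∀ s, q s = 0 → P s = 0 := fun s hs =>
    hPac s (le_antisymm (by simpa [hs] using hpq s) (hp s))
  have hlog : ∀ s, P s * Real.log (P s / q s) ≤ P s * Real.log (P s / p s) + κ * P s := by
    intro s
    rcases (hPs.1 s).eq_or_lt with h0 | h0
    · simp [← h0]
    have hps : 0 < p s := (hp s).lt_of_ne fun h => h0.ne' (hPac s h.symm)
    have hqs : 0 < q s := (hq.1 s).lt_of_ne fun h => h0.ne' (hac s h.symm)
    have hle : Real.log (p s) ≤ κ + Real.log (q s) := by
      have := Real.log_le_log hps (hpq s)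
      rwa [Real.log_mul (Real.exp_pos κ).ne' hqs.ne', Real.log_exp] at this
    rw [Real.log_div h0.ne' hqs.ne', Real.log_div h0.ne' hps.ne']
    nlinarith
  have hmixs : (fun s => (1 - t) * P s + t * q s) ∈ stdSimplex ℝ S := by
    refine ⟨fun s => add_nonneg (mul_nonneg (by linarith) (hPs.1 s))
      (mul_nonneg ht₀ (hq.1 s)), ?_⟩
    rw [Finset.sum_add_distrib, ← Finset.mul_sum, ← Finset.mul_sum, hPs.2, hq.2]
    ring
  refine ⟨fun s => (1 - t) * P s + t * q s, mem_klBall_iff.2 ⟨hmixs, ?_, ?_⟩, ?_⟩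
  · intro s hs
    simp [hs, hac s hs]
  · calc _ ≤ ∑ s, (1 - t) * (P s * Real.log (P s / p s) + κ * P s) := by
          refine Finset.sum_le_sum fun s _ => ?_
          rcases (hq.1 s).eq_or_lt with h0 | h0
          · simp [← h0, hac s h0.symm]
          · exact (mix_mul_log_le (hPs.1 s) h0 ht₀ ht₁).trans
              (mul_le_mul_of_nonneg_left (hlog s) (by linarith))
      _ = (1 - t) * (∑ s, P s * Real.log (P s / p s) + κ) := by
          rw [← Finset.mul_sum, Finset.sum_add_distrib, ← Finset.mul_sum, hPs.2, mul_one]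
      _ ≤ (1 - t) * (ρ + κ) := mul_le_mul_of_nonneg_left (by linarith) (by linarith)
      _ = ρ := by rw [ht]; field_simp; ring
  · have h1 := sum_mul_mem_Icc hPs hV
    have h2 := sum_mul_mem_Icc hq hV
    calc ∑ s, ((1 - t) * P s + t * q s) * V s
        = (1 - t) * ∑ s, P s * V s + t * ∑ s, q s * V s := by
          rw [Finset.mul_sum, Finset.mul_sum, ← Finset.sum_add_distrib]
          exact Finset.sum_congr rfl fun s _ => by ring
      _ ≤ ∑ s, P s * V s + t * B := by
          nlinarith [mul_nonneg ht₀ h1.1, mul_le_mul_of_nonneg_left h2.2 ht₀]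
      _ ≤ _ := by
          have := mul_le_mul_of_nonneg_right htρ (h2.1.trans h2.2)
          linarith

end KLBall

/-! ### First-step decompositions and the backward recursion -/

section Recursion

variable {S A : Type*} [Fintype S] {H : ℕ}

/-- Conditioning on the second state. A general integrand `f` lets this serve both the total mass
and the Bellman equation. -/
theorem sum_pathProb_mul_succ (P : Fin (H + 1) → S → A → S → ℝ) (π : Policy S A (H + 1))
    (s₀ : S) (f : (Fin (H + 2) → S) → ℝ) :
    ∑ x, pathProb P π s₀ x * f x =
      ∑ s, P 0 s₀ (π 0 s₀) s *
        ∑ y, pathProb (fun t => P t.succ) (fun t => π t.succ) s y * f (Fin.cons s₀ y) := by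
  classical
  rw [← (Fin.consEquiv fun _ => S).sum_comp, Fintype.sum_prod_type, Finset.sum_eq_single s₀]
  · simp_rw [Finset.mul_sum]
    rw [Finset.sum_comm]
    refine Finset.sum_congr rfl fun y _ => ?_
    -- The initial-state indicator of the tail path collapses the sum over `s` to `s = y 0`.
    rw [Finset.sum_eq_single (y 0)]
    · simp [pathProb, Fin.prod_univ_succ, Fin.consEquiv, mul_assoc]
    · intro b _ hb
      simp [pathProb, hb.symm]
    · simp
  · intro b _ hb
    exact Finset.sum_eq_zero fun y _ => by simp [pathProb, Fin.consEquiv, hb]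
  · simp

theorem sum_pathProb {P : Fin H → S → A → S → ℝ} (hP : ∀ h s a, P h s a ∈ stdSimplex ℝ S)
    (π : Policy S A H) (s₀ : S) : ∑ x, pathProb P π s₀ x = 1 := by
  classical
  induction H generalizing s₀ with
  | zero =>
    rw [← (Equiv.funUnique (Fin 1) S).symm.sum_comp]
    simp [pathProb]
  | succ H ih =>
    have h := sum_pathProb_mul_succ P π s₀ fun _ => 1
    simp only [mul_one] at h
    rw [h, ← (hP 0 s₀ (π 0 s₀)).2]
    exact Finset.sum_congr rfl fun s _ => by
      rw [ih (fun t => hP t.succ), mul_one]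

theorem value_zero (P : Fin 0 → S → A → S → ℝ) (r : Fin 0 → S → A → ℝ) (π : Policy S A 0)
    (s₀ : S) : value P r π s₀ = 0 := by
  simp [value]

/-- The Bellman equation of a policy in a fixed model. -/
theorem value_succ {P : Fin (H + 1) → S → A → S → ℝ} (hP : ∀ h s a, P h s a ∈ stdSimplex ℝ S)
    (r : Fin (H + 1) → S → A → ℝ) (π : Policy S A (H + 1)) (s₀ : S) :
    value P r π s₀ = r 0 s₀ (π 0 s₀) + ∑ s, P 0 s₀ (π 0 s₀) s *
      value (fun t => P t.succ) (fun t => r t.succ) (fun t => π t.succ) s := by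
  unfold value
  rw [sum_pathProb_mul_succ]
  have key : ∀ s, ∑ y, pathProb (fun t => P t.succ) (fun t => π t.succ) s y *
      (∑ t : Fin (H + 1), r t ((Fin.cons s₀ y : Fin (H + 2) → S) t.castSucc)
        (π t ((Fin.cons s₀ y : Fin (H + 2) → S) t.castSucc))) =
      r 0 s₀ (π 0 s₀) + ∑ y, pathProb (fun t => P t.succ) (fun t => π t.succ) s y *
        ∑ t : Fin H, r t.succ (y t.castSucc) (π t.succ (y t.castSucc)) := by
    intro s
    simp only [Fin.sum_univ_succ, mul_add, Finset.sum_add_distrib, ← Fin.succ_castSucc,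
      Fin.cons_succ, Fin.castSucc_zero, Fin.cons_zero]
    rw [← Finset.sum_mul, sum_pathProb (fun t => hP t.succ), one_mul]
  simp_rw [key, mul_add, Finset.sum_add_distrib, ← Finset.sum_mul]
  rw [(hP 0 s₀ _).2, one_mul]

theorem rpvlValue_last (ρ : ℝ) (r : Fin H → S → A → ℝ) (Q : Fin H → S → A → S → ℝ) :
    rpvlValue ρ r Q (Fin.last H) = fun _ => 0 := by
  simp [rpvlValue]

theorem rpvlValue_horizon_zero (ρ : ℝ) (r : Fin 0 → S → A → ℝ) (Q : Fin 0 → S → A → S → ℝ)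
    (s : S) : rpvlValue ρ r Q 0 s = 0 :=
  congrFun (rpvlValue_last ρ r Q) s

theorem rpvlValue_castSucc (ρ : ℝ) (r : Fin H → S → A → ℝ) (Q : Fin H → S → A → S → ℝ)
    (h : Fin H) :
    rpvlValue ρ r Q h.castSucc =
      fun s => ⨆ a : A, r h s a + worstExp ρ (Q h s a) (rpvlValue ρ r Q h.succ) := by
  simp [rpvlValue]

/-- The recursion runs backwards, so dropping the first stage leaves later values unchanged; this is
what permits induction on the horizon. -/
theorem rpvlValue_tail (ρ : ℝ) (r : Fin (H + 1) → S → A → ℝ) (Q : Fin (H + 1) → S → A → S → ℝ)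
    (h : Fin (H + 1)) :
    rpvlValue ρ (fun t => r t.succ) (fun t => Q t.succ) h = rpvlValue ρ r Q h.succ := by
  induction h using Fin.reverseInduction with
  | last => rw [rpvlValue_last, Fin.succ_last, rpvlValue_last]
  | cast i ih => rw [rpvlValue_castSucc, Fin.succ_castSucc, rpvlValue_castSucc, ih]

theorem rpvlValue_zero_succ (ρ : ℝ) (r : Fin (H + 1) → S → A → ℝ)
    (Q : Fin (H + 1) → S → A → S → ℝ) (s : S) :
    rpvlValue ρ r Q 0 s = ⨆ a : A, r 0 s a + worstExp ρ (Q 0 s a)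
      (rpvlValue ρ (fun t => r t.succ) (fun t => Q t.succ) 0) := by
  rw [rpvlValue_tail]
  exact congrFun (rpvlValue_castSucc ρ r Q 0) s

theorem rpvlOutputs_tail {ρ : ℝ} {r : Fin (H + 1) → S → A → ℝ}
    {Q : Fin (H + 1) → S → A → S → ℝ} {π : Policy S A (H + 1)} (hπ : π ∈ rpvlOutputs ρ r Q) :
    (fun t => π t.succ) ∈ rpvlOutputs ρ (fun t => r t.succ) (fun t => Q t.succ) := by
  intro h s a
  rw [rpvlValue_tail]
  exact hπ h.succ s a

theorem rpvlValue_mem_Icc [Finite A] [Nonempty A] {ρ : ℝ} (hρ : 0 ≤ ρ) {r : Fin H → S → A → ℝ}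
    (hr : ∀ h s a, r h s a ∈ Set.Icc (0 : ℝ) 1) {Q : Fin H → S → A → S → ℝ}
    (hQ : ∀ h s a, Q h s a ∈ stdSimplex ℝ S) (s : S) :
    rpvlValue ρ r Q 0 s ∈ Set.Icc (0 : ℝ) H := by
  induction H generalizing s with
  | zero => simp [rpvlValue_horizon_zero]
  | succ H ih =>
    have hV := ih (fun t => hr t.succ) (fun t => hQ t.succ)
    rw [rpvlValue_zero_succ]
    constructor
    · exact Real.iSup_nonneg fun a =>
        add_nonneg (hr 0 s a).1 (worstExp_nonneg _ _ fun s => (hV s).1)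
    · refine ciSup_le fun a => ?_
      have h1 := worstExp_le (fun s => (hV s).1) (self_mem_klBall hρ (hQ 0 s a))
      have h2 := (sum_mul_mem_Icc (hQ 0 s a) hV).2
      have h3 := (hr 0 s a).2
      push_cast
      linarith

theorem value_mem_Icc {P : Fin H → S → A → S → ℝ} (hP : ∀ h s a, P h s a ∈ stdSimplex ℝ S)
    {r : Fin H → S → A → ℝ} (hr : ∀ h s a, r h s a ∈ Set.Icc (0 : ℝ) 1) (π : Policy S A H)
    (s : S) : value P r π s ∈ Set.Icc (0 : ℝ) H := by
  induction H generalizing s with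
  | zero => simp [value_zero]
  | succ H ih =>
    have h2 := sum_mul_mem_Icc (hP 0 s (π 0 s))
      (ih (fun t => hP t.succ) (fun t => hr t.succ) fun t => π t.succ)
    have h3 := hr 0 s (π 0 s)
    rw [value_succ hP]
    push_cast
    exact ⟨by linarith [h2.1, h3.1], by linarith [h2.2, h3.2]⟩

end Recursion

/-! ### Accumulation of the estimation error over the stages -/

section ErrorPropagation

variable {S A : Type*} [Fintype S] [Finite A] [Nonempty A] {H : ℕ} {ρ κ : ℝ}
  {r : Fin H → S → A → ℝ} {P₀ Q : Fin H → S → A → S → ℝ}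

theorem sum_mul_add_const {P V : S → ℝ} (hP : P ∈ stdSimplex ℝ S) (c : ℝ) :
    ∑ s, P s * (V s + c) = ∑ s, P s * V s + c := by
  simp_rw [mul_add, Finset.sum_add_distrib, ← Finset.sum_mul, hP.2, one_mul]

/-- In every model of the uncertainty set around `P₀`, a greedy policy of the recursion run on `Q`
does almost as well as that recursion predicts. -/
theorem rpvlValue_le_value_add (hρ : 0 < ρ) (hκ : 0 ≤ κ)
    (hr : ∀ h s a, r h s a ∈ Set.Icc (0 : ℝ) 1) (hP₀ : ∀ h s a, P₀ h s a ∈ stdSimplex ℝ S)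
    (hQ : ∀ h s a, Q h s a ∈ stdSimplex ℝ S)
    (hPQ : ∀ h s a s', P₀ h s a s' ≤ Real.exp κ * Q h s a s')
    {π : Policy S A H} (hπ : π ∈ rpvlOutputs ρ r Q) {P : Fin H → S → A → S → ℝ}
    (hP : ∀ h s a, P h s a ∈ klBall ρ (P₀ h s a)) (s : S) :
    rpvlValue ρ r Q 0 s ≤ value P r π s + κ / ρ * H ^ 2 / 2 := by
  induction H generalizing s with
  | zero => simp [rpvlValue_horizon_zero, value_zero]
  | succ H ih =>
    have hV := rpvlValue_mem_Icc hρ.le (fun t => hr t.succ) (fun t => hQ t.succ)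
    have hih := ih (fun t => hr t.succ) (fun t => hP₀ t.succ) (fun t => hQ t.succ)
      (fun t => hPQ t.succ) (rpvlOutputs_tail hπ) (fun t => hP t.succ)
    have hPs := (hP 0 s (π 0 s)).1
    obtain ⟨Q', hQ', hle⟩ := exists_mem_klBall_le_add hρ hκ (hQ 0 s (π 0 s)) (hPQ 0 s (π 0 s))
      (hP₀ 0 s (π 0 s)).1 (hP 0 s (π 0 s)) hV
    have hw := worstExp_le (fun s => (hV s).1) hQ'
    have hsum := Finset.sum_le_sum fun s' (_ : s' ∈ Finset.univ) =>
      mul_le_mul_of_nonneg_left (hih s') (hPs.1 s')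
    rw [sum_mul_add_const hPs] at hsum
    rw [value_succ fun h s a => (hP h s a).1, rpvlValue_zero_succ]
    refine ciSup_le fun a => ?_
    have hg := hπ 0 s a
    rw [← rpvlValue_tail] at hg
    have hc : 0 ≤ κ / ρ := by positivity
    push_cast
    -- The error recursion closes because `H + H ^ 2 / 2 ≤ (H + 1) ^ 2 / 2`.
    nlinarith

/-- For every policy, some model of the uncertainty set around `P₀` makes it do hardly better than
the recursion run on `Q` predicts. -/
theorem exists_value_le_rpvlValue_add (hρ : 0 < ρ) (hκ : 0 ≤ κ)
    (hr : ∀ h s a, r h s a ∈ Set.Icc (0 : ℝ) 1) (hP₀ : ∀ h s a, P₀ h s a ∈ stdSimplex ℝ S)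
    (hQ : ∀ h s a, Q h s a ∈ stdSimplex ℝ S)
    (hQP : ∀ h s a s', Q h s a s' ≤ Real.exp κ * P₀ h s a s')
    (π : Policy S A H) {η : ℝ} (hη : 0 < η) :
    ∃ P : Fin H → S → A → S → ℝ, (∀ h s a, P h s a ∈ klBall ρ (P₀ h s a)) ∧
      ∀ s, value P r π s ≤ rpvlValue ρ r Q 0 s + (κ / ρ * H ^ 2 / 2 + η * H) := by
  induction H with
  | zero =>
    exact ⟨P₀, fun h => h.elim0, fun s => by
      simp [rpvlValue_horizon_zero, value_zero]⟩
  | succ H ih =>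
    have hV := rpvlValue_mem_Icc hρ.le (fun t => hr t.succ) (fun t => hQ t.succ)
    obtain ⟨P', hP', hle'⟩ := ih (fun t => hr t.succ) (fun t => hP₀ t.succ) (fun t => hQ t.succ)
      (fun t => hQP t.succ) (fun t => π t.succ)
    -- A nearly worst law around `Q`, moved to the ball around `P₀`. Rectangularity allows an
    -- independent choice for each `(s, a)`, and then gluing with the later stages.
    have hex : ∀ s a, ∃ p ∈ klBall ρ (P₀ 0 s a),
        ∑ s', p s' * rpvlValue ρ (fun t => r t.succ) (fun t => Q t.succ) 0 s' ≤
          worstExp ρ (Q 0 s a) (rpvlValue ρ (fun t => r t.succ) (fun t => Q t.succ) 0) + η +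
            κ / ρ * H := by
      intro s a
      obtain ⟨q, hq, hlt⟩ := exists_mem_klBall_lt_worstExp_add hρ.le (hQ 0 s a)
        (rpvlValue ρ (fun t => r t.succ) (fun t => Q t.succ) 0) hη
      obtain ⟨p, hp, hle⟩ := exists_mem_klBall_le_add hρ hκ (hP₀ 0 s a) (hQP 0 s a)
        (hQ 0 s a).1 hq hV
      exact ⟨p, hp, by linarith⟩
    choose p hp hple using hex
    have hmem : ∀ h s a, (Fin.cons p P' : Fin (H + 1) → S → A → S → ℝ) h s a ∈
        klBall ρ (P₀ h s a) := by
      intro h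
      induction h using Fin.cases with
      | zero => exact hp
      | succ h => exact hP' h
    refine ⟨Fin.cons p P', hmem, fun s => ?_⟩
    rw [value_succ fun h s a => (hmem h s a).1, rpvlValue_zero_succ]
    simp only [Fin.cons_zero, Fin.cons_succ]
    have hsum := Finset.sum_le_sum fun s' (_ : s' ∈ Finset.univ) =>
      mul_le_mul_of_nonneg_left (hle' s') ((hp s (π 0 s)).1.1 s')
    rw [sum_mul_add_const (hp s (π 0 s)).1] at hsum
    have hsup := le_ciSup (f := fun a => r 0 s a + worstExp ρ (Q 0 s a)
      (rpvlValue ρ (fun t => r t.succ) (fun t => Q t.succ) 0)) (Set.finite_range _).bddAbove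
      (π 0 s)
    have hc : 0 ≤ κ / ρ := by positivity
    have := hple s (π 0 s)
    push_cast
    nlinarith

end ErrorPropagation

/-! ### Suboptimality of the learnt policy -/

section Robust

variable {S A : Type*} [Fintype S] {H : ℕ} (M : NominalMDP S A H) {ρ : ℝ}

theorem NominalMDP.trans_mem_uncertaintySet (hρ : 0 ≤ ρ) : M.trans ∈ M.uncertaintySet ρ :=
  fun h s a => self_mem_klBall hρ (M.trans_mem h s a)

theorem NominalMDP.robustValue_le {P : Fin H → S → A → S → ℝ} (hP : P ∈ M.uncertaintySet ρ)
    (π : Policy S A H) (s : S) : M.robustValue ρ π s ≤ value P M.reward π s := by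
  refine ciInf_le (f := fun P : M.uncertaintySet ρ => value P.1 M.reward π s) ⟨0, ?_⟩ ⟨P, hP⟩
  rintro _ ⟨P', rfl⟩
  exact (value_mem_Icc (fun h s a => (P'.2 h s a).1) M.reward_mem π s).1

/-- If the estimated model has log-ratio at most `κ` to the nominal one, the learnt policy is
`κ H² / ρ`-optimal for the robust problem. -/
theorem NominalMDP.norm_optRobustValue_sub_le [Finite A] [Nonempty A] (hρ : 0 < ρ) {κ : ℝ}
    (hκ : 0 ≤ κ) {Q : Fin H → S → A → S → ℝ} (hQ : ∀ h s a, Q h s a ∈ stdSimplex ℝ S)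
    (hPQ : ∀ h s a s', M.trans h s a s' ≤ Real.exp κ * Q h s a s')
    (hQP : ∀ h s a s', Q h s a s' ≤ Real.exp κ * M.trans h s a s')
    {πhat : Policy S A H} (hπ : πhat ∈ rpvlOutputs ρ M.reward Q) :
    ‖M.optRobustValue ρ - M.robustValue ρ πhat‖ ≤ κ / ρ * H ^ 2 := by
  have : Nonempty (M.uncertaintySet ρ) := ⟨⟨_, M.trans_mem_uncertaintySet hρ.le⟩⟩
  refine (pi_norm_le_iff_of_nonneg (by positivity)).2 fun s => ?_
  have hlow : rpvlValue ρ M.reward Q 0 s ≤ M.robustValue ρ πhat s + κ / ρ * H ^ 2 / 2 := by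
    rw [← sub_le_iff_le_add]
    exact le_ciInf fun P => sub_le_iff_le_add.2 <|
      rpvlValue_le_value_add hρ hκ M.reward_mem M.trans_mem hQ hPQ hπ P.2 s
  have hup : M.optRobustValue ρ s ≤ rpvlValue ρ M.reward Q 0 s + κ / ρ * H ^ 2 / 2 := by
    refine ciSup_le fun π => le_of_forall_pos_le_add fun η hη => ?_
    -- The slack is spent once per stage, hence `η / (H + 1)`, which also makes sense for `H = 0`.
    obtain ⟨P, hP, hle⟩ := exists_value_le_rpvlValue_add hρ hκ M.reward_mem M.trans_mem hQ hQP π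
      (η := η / (H + 1)) (by positivity)
    have h1 := (M.robustValue_le hP π s).trans (hle s)
    have h2 : η / (H + 1) * H ≤ η := by
      rw [div_mul_eq_mul_div, div_le_iff₀ (by positivity)]
      nlinarith
    linarith
  have hge : M.robustValue ρ πhat s ≤ M.optRobustValue ρ s :=
    le_ciSup (f := fun π => M.robustValue ρ π s) (Set.finite_range _).bddAbove πhat
  rw [Pi.sub_apply, Real.norm_eq_abs, abs_of_nonneg (by linarith)]
  linarith

end Robust


/-! ### Concentration of the empirical frequencies -/

section Concentration

open MeasureTheory ProbabilityTheory

variable {S A Ω : Type*} {H N : ℕ}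

theorem empirical_mem_stdSimplex [Fintype S] (hN : 0 < N) (X : Fin H → S → A → Fin N → Ω → S)
    (ω : Ω) (h : Fin H) (s : S) (a : A) : empirical X ω h s a ∈ stdSimplex ℝ S := by
  classical
  refine ⟨fun s' => by unfold empirical; positivity, ?_⟩
  have hc := Finset.card_eq_sum_card_fiberwise (s := (Finset.univ : Finset (Fin N)))
    (t := (Finset.univ : Finset S)) (f := fun i => X h s a i ω) (fun _ _ => by simp)
  have hN' : (N : ℝ) ≠ 0 := by exact_mod_cast hN.ne'
  unfold empirical
  rw [← Finset.sum_div, div_eq_one_iff_eq hN', ← Nat.cast_sum]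
  norm_cast
  simpa using hc.symm

/-- Hoeffding's inequality for relative frequencies, in both directions. -/
theorem measureReal_le_abs_frequency_sub_le [MeasurableSpace S] [MeasurableSingletonClass S]
    [MeasurableSpace Ω] {μ : Measure Ω} [IsProbabilityMeasure μ] (hN : 0 < N)
    {Y : Fin N → Ω → S} (hY : ∀ i, Measurable (Y i)) (hindep : iIndepFun Y μ) (s' : S) {p : ℝ}
    (hp : ∀ i, μ.real {ω | Y i ω = s'} = p) {t : ℝ} (ht : 0 ≤ t) :
    μ.real {ω | t ≤ |(∑ i, (({s'} : Set S).indicator 1 (Y i ω) : ℝ)) / N - p|} ≤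
      2 * Real.exp (-2 * N * t ^ 2) := by
  have hN' : (0 : ℝ) < N := by exact_mod_cast hN
  have hg : Measurable (({s'} : Set S).indicator (1 : S → ℝ)) :=
    measurable_one.indicator (measurableSet_singleton s')
  have hint : ∀ i, ∫ ω, ({s'} : Set S).indicator (1 : S → ℝ) (Y i ω) ∂μ = p := by
    intro i
    rw [← hp i]
    exact integral_indicator_one (hY i (measurableSet_singleton s'))
  have hsub : ∀ i, HasSubgaussianMGF
      (fun ω => ({s'} : Set S).indicator (1 : S → ℝ) (Y i ω) - p) ((‖(1 : ℝ) - 0‖₊ / 2) ^ 2) μ := by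
    intro i
    have := hasSubgaussianMGF_of_mem_Icc (μ := μ) (a := 0) (b := 1)
      (X := fun ω => ({s'} : Set S).indicator (1 : S → ℝ) (Y i ω)) (hg.comp (hY i)).aemeasurable
      (Filter.Eventually.of_forall fun ω => by
        by_cases h : Y i ω = s' <;> simp [h])
    rwa [hint i] at this
  have hi : iIndepFun (fun i ω => ({s'} : Set S).indicator (1 : S → ℝ) (Y i ω) - p) μ :=
    hindep.comp (fun _ y => ({s'} : Set S).indicator (1 : S → ℝ) y - p)
      fun _ => hg.sub_const p
  have hi' : iIndepFun (fun i ω => -(({s'} : Set S).indicator (1 : S → ℝ) (Y i ω) - p)) μ :=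
    hi.comp (fun _ y => -y) fun _ => measurable_neg
  -- Each indicator has variance proxy `1 / 4`, so the `N` of them together have `N / 4`.
  have hexp : -(N * t) ^ 2 / (2 * ((∑ _i : Fin N, (‖(1 : ℝ) - 0‖₊ / 2) ^ 2 : NNReal) : ℝ)) =
      -2 * N * t ^ 2 := by
    simp
    field_simp
  have h1 := HasSubgaussianMGF.measure_sum_ge_le_of_iIndepFun hi (s := Finset.univ)
    (fun i _ => hsub i) (ε := N * t) (by positivity)
  have h2 := HasSubgaussianMGF.measure_sum_ge_le_of_iIndepFun hi' (s := Finset.univ)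
    (fun i _ => (hsub i).neg) (ε := N * t) (by positivity)
  push_cast at h1 h2 hexp
  rw [hexp] at h1 h2
  refine (measureReal_mono (fun ω hω => ?_) (measure_ne_top _ _)).trans
    ((measureReal_union_le _ _).trans ((add_le_add h1 h2).trans_eq (two_mul _).symm))
  have e : (∑ i, ({s'} : Set S).indicator (1 : S → ℝ) (Y i ω)) / N - p =
      (∑ i, (({s'} : Set S).indicator (1 : S → ℝ) (Y i ω) - p)) / N := by
    rw [Finset.sum_sub_distrib]
    simp
    field_simp
  simp only [Set.mem_ofPred_eq, e, le_abs] at hω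
  refine hω.imp (fun h => ?_) fun h => ?_
  · rw [le_div_iff₀ hN'] at h
    simpa [mul_comm] using h
  · rw [← neg_div, le_div_iff₀ hN', ← Finset.sum_neg_distrib] at h
    simpa [mul_comm] using h

variable [Fintype S] [MeasurableSpace S] [MeasurableSpace Ω]
  {μ : Measure Ω} [IsProbabilityMeasure μ] {M : NominalMDP S A H}
  {X : Fin H → S → A → Fin N → Ω → S}

/-- Additive closeness does not suffice where the nominal probability is zero: the multiplicative
comparison forces the estimate to vanish there. -/
theorem IsGenerativeSample.measureReal_empirical_ne_zero (hX : IsGenerativeSample M μ X)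
    {h : Fin H} {s : S} {a : A} {s' : S} (h0 : M.trans h s a s' = 0) :
    μ.real {ω | empirical X ω h s a s' ≠ 0} = 0 := by
  refine le_antisymm ?_ measureReal_nonneg
  calc _ ≤ μ.real (⋃ i, {ω | X h s a i ω = s'}) := by
        refine measureReal_mono (fun ω hω => ?_) (measure_ne_top _ _)
        by_contra hc
        simp only [Set.mem_iUnion, Set.mem_ofPred_eq, not_exists] at hc
        exact hω (by simp [empirical, hc])
    _ ≤ ∑ i, μ.real {ω | X h s a i ω = s'} := measureReal_iUnion_fintype_le _
    _ = 0 := Finset.sum_eq_zero fun i _ => by rw [hX.law, h0]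

variable [MeasurableSingletonClass S]

theorem IsGenerativeSample.measureReal_empirical_dev_le (hX : IsGenerativeSample M μ X)
    (hN : 0 < N) {t : ℝ} (ht : 0 ≤ t) (h : Fin H) (s : S) (a : A) (s' : S) :
    μ.real {ω | t ≤ |empirical X ω h s a s' - M.trans h s a s'|} ≤
      2 * Real.exp (-2 * N * t ^ 2) := by
  classical
  have hind : iIndepFun (fun i => X h s a i) μ :=
    hX.indep.precomp (g := fun i : Fin N => (h, s, a, i)) fun i j hij => by simpa using hij
  convert measureReal_le_abs_frequency_sub_le hN (hX.measurable h s a) hind s'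
    (fun i => hX.law h s a i s') ht using 7 with ω
  simp [empirical, Set.indicator_apply, Finset.sum_boole]

/-- With probability at least `1 - 2 H |S|² |A| exp (-2 N t²)`, all empirical frequencies are within
`t` of the nominal probabilities, and vanish where these do. -/
theorem IsGenerativeSample.le_measureReal_empirical_close [Fintype A]
    (hX : IsGenerativeSample M μ X) (hN : 0 < N) {t : ℝ} (ht : 0 ≤ t) :
    1 - 2 * H * (Fintype.card S : ℝ) ^ 2 * Fintype.card A * Real.exp (-2 * N * t ^ 2) ≤
      μ.real {ω | ∀ h s a s', (M.trans h s a s' = 0 → empirical X ω h s a s' = 0) ∧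
        |empirical X ω h s a s' - M.trans h s a s'| ≤ t} := by
  set G := {ω | ∀ h s a s', (M.trans h s a s' = 0 → empirical X ω h s a s' = 0) ∧
    |empirical X ω h s a s' - M.trans h s a s'| ≤ t}
  let bad : Fin H × S × A × S → Set Ω := fun k =>
    {ω | ¬ ((M.trans k.1 k.2.1 k.2.2.1 k.2.2.2 = 0 → empirical X ω k.1 k.2.1 k.2.2.1 k.2.2.2 = 0) ∧
      |empirical X ω k.1 k.2.1 k.2.2.1 k.2.2.2 - M.trans k.1 k.2.1 k.2.2.1 k.2.2.2| ≤ t)}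
  have hbad : ∀ k, μ.real (bad k) ≤ 2 * Real.exp (-2 * N * t ^ 2) := by
    rintro ⟨h, s, a, s'⟩
    by_cases h0 : M.trans h s a s' = 0
    · refine (measureReal_mono (fun ω hω => ?_) (measure_ne_top _ _)).trans
        ((hX.measureReal_empirical_ne_zero h0).le.trans (by positivity))
      intro he
      exact hω ⟨fun _ => he, by simpa [he, h0] using ht⟩
    · refine (measureReal_mono (fun ω hω => ?_) (measure_ne_top _ _)).trans
        (hX.measureReal_empirical_dev_le hN ht h s a s')
      by_contra hc
      exact hω ⟨fun h => absurd h h0, (not_le.1 hc).le⟩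
  have hcov : (Set.univ : Set Ω) ⊆ G ∪ ⋃ k, bad k := by
    intro ω _
    by_cases hω : ω ∈ G
    · exact Or.inl hω
    · simp only [G, Set.mem_ofPred_eq, not_forall] at hω
      obtain ⟨h, s, a, s', hk⟩ := hω
      exact Or.inr (Set.mem_iUnion.2 ⟨(h, s, a, s'), hk⟩)
  have h1 : (1 : ℝ) ≤ μ.real G + ∑ k, μ.real (bad k) :=
    calc (1 : ℝ) = μ.real Set.univ := by simp
      _ ≤ μ.real (G ∪ ⋃ k, bad k) := measureReal_mono hcov (measure_ne_top _ _)
      _ ≤ _ := (measureReal_union_le _ _).trans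
          (by gcongr; exact measureReal_iUnion_fintype_le _)
  have h2 := Finset.sum_le_sum fun k (_ : k ∈ Finset.univ) => hbad k
  have h3 : (∑ _k : Fin H × S × A × S, 2 * Real.exp (-2 * N * t ^ 2)) =
      2 * H * (Fintype.card S : ℝ) ^ 2 * Fintype.card A * Real.exp (-2 * N * t ^ 2) := by
    simp
    ring
  linarith

end Concentration

/-! ### The smallest positive transition probability -/

section Pmin

variable {S A : Type*} [Fintype S] {H : ℕ} (M : NominalMDP S A H)

theorem NominalMDP.pmin_le {h : Fin H} {s : S} {a : A} {s' : S} (hpos : 0 < M.trans h s a s') :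
    M.pmin ≤ M.trans h s a s' :=
  csInf_le ⟨0, fun _ hp => hp.1.le⟩ ⟨hpos, h, s, a, s', rfl⟩

theorem NominalMDP.pmin_pos [Finite A] [Nonempty S] [Nonempty A] (hH : 0 < H) : 0 < M.pmin := by
  have hfin : {p | 0 < p ∧ ∃ h s a s', p = M.trans h s a s'}.Finite := by
    refine (Set.finite_range fun k : Fin H × S × A × S =>
      M.trans k.1 k.2.1 k.2.2.1 k.2.2.2).subset ?_
    rintro _ ⟨_, h, s, a, s', rfl⟩
    exact ⟨(h, s, a, s'), rfl⟩
  obtain ⟨s⟩ := ‹Nonempty S›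
  obtain ⟨a⟩ := ‹Nonempty A›
  have hne : {p | 0 < p ∧ ∃ h s a s', p = M.trans h s a s'}.Nonempty := by
    obtain ⟨s', _, hs'⟩ : ∃ s' ∈ Finset.univ, 0 < M.trans ⟨0, hH⟩ s a s' :=
      Finset.exists_lt_of_sum_lt (f := fun _ => 0) (by simp [(M.trans_mem ⟨0, hH⟩ s a).2])
    exact ⟨_, hs', _, s, a, s', rfl⟩
  exact (hne.csInf_mem hfin).1

end Pmin

/-! ### From additive to multiplicative error -/

/-- On `[-3/2, 0]` the exponential lies below its chord, and `exp (-3/2) ≤ 1/4` puts that chord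
below the line `1 - x`. -/
theorem exp_neg_two_mul_le_one_sub {x : ℝ} (h0 : 0 ≤ x) (h1 : x ≤ 3 / 4) :
    Real.exp (-(2 * x)) ≤ 1 - x := by
  have hc := convexOn_exp.2 (Set.mem_univ (0 : ℝ)) (Set.mem_univ (-(3 / 2) : ℝ))
    (show 0 ≤ 1 - 4 / 3 * x by linarith) (show 0 ≤ 4 / 3 * x by linarith) (by ring)
  have he : Real.exp (-(3 / 2)) ≤ 1 / 4 := by
    have h := Real.quadratic_le_exp_of_nonneg (x := 3 / 4) (by norm_num)
    have h2 : Real.exp (3 / 2) = Real.exp (3 / 4) ^ 2 := by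
      rw [← Real.exp_nat_mul]; norm_num
    rw [Real.exp_neg, inv_le_comm₀ (Real.exp_pos _) (by norm_num), h2]
    nlinarith
  simp only [smul_eq_mul, mul_zero, zero_add, Real.exp_zero, mul_one] at hc
  rw [show 4 / 3 * x * -(3 / 2) = -(2 * x) by ring] at hc
  nlinarith

/-- For a mass of at least `m`, an absolute error `t` is a relative error of at most `t / m`. The
factor `2` in the exponent is what the lower bound `1 - t / m` requires. -/
theorem le_exp_mul_of_abs_sub_le {p q t m : ℝ} (ht : 0 ≤ t) (hm : 0 < m) (hmp : m ≤ p)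
    (htm : t ≤ 3 / 4 * m) (h : |q - p| ≤ t) :
    p ≤ Real.exp (2 * (t / m)) * q ∧ q ≤ Real.exp (2 * (t / m)) * p := by
  have hx0 : 0 ≤ t / m := by positivity
  have hx1 : t / m ≤ 3 / 4 := (div_le_iff₀ hm).2 htm
  have htp : t ≤ t / m * p := by
    calc t = t / m * m := by field_simp
      _ ≤ _ := mul_le_mul_of_nonneg_left hmp hx0
  obtain ⟨hl, hu⟩ := abs_le.1 h
  have hp : 0 ≤ p := hm.le.trans hmp
  constructor
  · have he := exp_neg_two_mul_le_one_sub hx0 hx1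
    have : Real.exp (-(2 * (t / m))) * p ≤ q := by nlinarith
    calc p = Real.exp (2 * (t / m)) * (Real.exp (-(2 * (t / m))) * p) := by
          rw [← mul_assoc, ← Real.exp_add]; simp
      _ ≤ _ := mul_le_mul_of_nonneg_left this (Real.exp_pos _).le
  · have he := Real.add_one_le_exp (2 * (t / m))
    nlinarith

end RobustMDP

/-! ### Choice of the accuracy and conclusion -/

theorem theorem4 {S A Ω : Type*} [Fintype S] [Nonempty S] [Fintype A] [Nonempty A]
    [MeasurableSpace S] [MeasurableSingletonClass S] [MeasurableSpace Ω]
    (μ : MeasureTheory.Measure Ω) [MeasureTheory.IsProbabilityMeasure μ]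
    {H N : ℕ} (M : RobustMDP.NominalMDP S A H)
    (X : Fin H → S → A → Fin N → Ω → S) (hX : RobustMDP.IsGenerativeSample M μ X)
    (δ ρ ε : ℝ) (hδ : δ ∈ Set.Ioo (0 : ℝ) 1) (hρ : 0 < ρ) (hε : ε ∈ Set.Ioo (0 : ℝ) H)
    (hN : 2 * (H : ℝ) ^ 5 * Fintype.card S * Fintype.card A / (ρ ^ 2 * M.pmin ^ 2 * ε ^ 2) *
        Real.log (2 * H * (Fintype.card S : ℝ) ^ 2 * Fintype.card A / δ) ≤
      (N : ℝ) * Fintype.card S * Fintype.card A * H)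
    (hN₀ : Real.log (2 * H * (Fintype.card S : ℝ) ^ 2 * Fintype.card A / δ) / M.pmin ^ 2 ≤
      (N : ℝ)) :
    1 - δ ≤ μ.real {ω | ∀ πhat ∈ RobustMDP.rpvlOutputs ρ M.reward (RobustMDP.empirical X ω),
      ‖M.optRobustValue ρ - M.robustValue ρ πhat‖ ≤ ε} := by
  obtain ⟨hδ0, hδ1⟩ := hδ
  obtain ⟨hε0, hεH⟩ := hε
  have hH : 0 < H := by exact_mod_cast hε0.trans hεH
  have hH1 : (1 : ℝ) ≤ H := by exact_mod_cast hH
  have hS1 : (1 : ℝ) ≤ Fintype.card S := by exact_mod_cast Fintype.card_pos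
  have hA1 : (1 : ℝ) ≤ Fintype.card A := by exact_mod_cast Fintype.card_pos
  have hm := M.pmin_pos hH
  set m := M.pmin
  set K : ℝ := 2 * H * (Fintype.card S : ℝ) ^ 2 * Fintype.card A with hK
  have hK2 : 1 ≤ K := by
    have h1 := one_le_mul_of_one_le_of_one_le (one_le_mul_of_one_le_of_one_le hH1
      (one_le_pow₀ hS1 (n := 2))) hA1
    linarith
  have hK0 : 0 < K := by linarith
  have hL : 0 < Real.log (K / δ) := Real.log_pos ((one_lt_div hδ0).2 (by linarith))
  set L := Real.log (K / δ) with hLdef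
  have hNpos : (0 : ℝ) < N := lt_of_lt_of_le (by positivity) hN₀
  have hN' : 0 < N := by exact_mod_cast hNpos
  -- The accuracy for which the failure bound `K * exp (-2 N t²)` equals `δ`.
  set t := √(L / (2 * N)) with ht
  have ht0 : 0 ≤ t := Real.sqrt_nonneg _
  have htsq : t ^ 2 = L / (2 * N) := Real.sq_sqrt (by positivity)
  have hprob : K * Real.exp (-2 * N * t ^ 2) = δ := by
    have : -2 * N * t ^ 2 = -L := by rw [htsq]; field_simp
    rw [this, Real.exp_neg, hLdef, Real.exp_log (by positivity)]
    field_simp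
  -- The second sample-size condition gives `t² ≤ m² / 2`, and `1/2 ≤ 9/16`.
  have htm : t ≤ 3 / 4 * m := by
    refine abs_le_of_sq_le_sq' ?_ (by positivity) |>.2
    rw [div_le_iff₀ (by positivity)] at hN₀
    rw [htsq, div_le_iff₀ (by positivity)]
    nlinarith [mul_pos hNpos (pow_pos hm 2)]
  -- Squared, this reads `2 H⁴ L / N ≤ ρ² m² ε²`: the first sample-size condition after cancelling
  -- `H |S| |A|`.
  have hHm : t * (2 * H ^ 2) ≤ ρ * m * ε := by
    refine abs_le_of_sq_le_sq' ?_ (by positivity) |>.2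
    rw [div_mul_eq_mul_div, div_le_iff₀ (by positivity)] at hN
    rw [mul_pow, htsq, div_mul_eq_mul_div, div_le_iff₀ (by positivity)]
    have hc : (0 : ℝ) < H * Fintype.card S * Fintype.card A := by positivity
    refine le_of_mul_le_mul_left ?_ hc
    linarith
  have hκ : 2 * (t / m) / ρ * H ^ 2 ≤ ε := by
    rw [show 2 * (t / m) / ρ * (H : ℝ) ^ 2 = t * (2 * H ^ 2) / (ρ * m) by field_simp,
      div_le_iff₀ (by positivity)]
    linarith
  refine (hprob ▸ hX.le_measureReal_empirical_close hN' ht0).trans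
    (MeasureTheory.measureReal_mono (fun ω hω πhat hπ => ?_) (MeasureTheory.measure_ne_top _ _))
  have hclose : ∀ h s a s', M.trans h s a s' ≤
        Real.exp (2 * (t / m)) * RobustMDP.empirical X ω h s a s' ∧
      RobustMDP.empirical X ω h s a s' ≤ Real.exp (2 * (t / m)) * M.trans h s a s' := by
    intro h s a s'
    obtain ⟨hz, hle⟩ := hω h s a s'
    rcases ((M.trans_mem h s a).1 s').eq_or_lt with h0 | h0
    · simp [← h0, hz h0.symm]
    · exact RobustMDP.le_exp_mul_of_abs_sub_le ht0 hm (M.pmin_le h0) htm hle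
  exact (M.norm_optRobustValue_sub_le hρ (by positivity)
    (RobustMDP.empirical_mem_stdSimplex hN' X ω) (fun h s a s' => (hclose h s a s').1)
    (fun h s a s' => (hclose h s a s').2) hπ).trans hκ
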